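/- Let $\Sigma$ be a closed connected Riemann surface, $p:\widetilde\Sigma\to\Sigma$ its universal covering (with the pulled-back complex structure), and let $\pi_1(\Sigma)$ act on $\widetilde\Sigma$ by deck transformations. Let $\rho_1,\rho_2:\pi_1(\Sigma)\to SL(2,\mathbb R)$ be representations and, for $i=1,2$, let $\psi_i:\widetilde\Sigma\to\mathbb H$ be a $\rho_i$-equivariant harmonic map to the hyperbolic plane, that is, the upper half-plane $\{\tau=u+iv : v>0\}$ with its standard orientation and the metric $g_{\mathbb H}=(du^2+dv^2)/v^2$ of curvature $-1$, whose area form is $\mathrm{Vol}(g_{\mathbb H})=v^{-2}du\wedge dv$. *Higgs bundle data of $(\rho_i,\psi_i)$.* Identify $\mathbb H=SL(2,\mathbb R)/SO(2)$ with the space of metrics of determinant $1$ on $\mathbb R^2$ by $g\cdot i\mapsto (gg^T)^{-1}$. Then $\psi_i$ is a Hermitian metric $H_i$ on the flat bundle $E_i^{\mathbb C}=(\widetilde\Sigma\times\mathbb C^2)/\pi_1(\Sigma)$, $\gamma\cdot(x,v)=(\gamma x,\rho_i(\gamma)v)$. Write the flat connection as $d=D_{H_i}+\Psi_i$ with $D_{H_i}$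 $H_i$-unitary and $\Psi_i=-\frac12H_i^{-1}dH_i$ $H_i$-self-adjoint; the Higgs field $\phi_i$ is the $(1,0)$-part of $\Psi_i$. Let $J_i$ be the rotation by $+\pi/2$ of the oriented real bundle $E_i$ (whose fibres are oriented by the standard orientation of $\mathbb R^2$) with respect to the metric, and let $E_1^{\mathbb C}=L\oplus L^{-1}$ and $E_2^{\mathbb C}=N\oplus N^{-1}$ be the decompositions into eigenbundles of $J_i$ for the eigenvalues $-i$ and $+i$, in this order; the two summands are dual to each other through the complex bilinear extension of the metric. Let $z=x+iy$ be a holomorphic coordinate on an open set $V\subset\Sigma$, and let $(e,e')$ be any frame of $E_1^{\mathbb C}$ over $V$ consisting of a section of $L$ and the dual section of $L^{-1}$ (for example a holomorphic one); likewise for $E_2^{\mathbb C}=N\oplus N^{-1}$. **Claim.** The tensors $\psi_i^*g_{\mathbb H}$ and $\psi_i^*\mathrm{Vol}(g_{\mathbb H})$ descend to unique $2$-tensors $g_i$ and $\mathrm{Vol}(g_i)$ on $\Sigma$. For all such coordinates and frames, there are functions $\alpha,\beta,\gamma,\delta:V\to\mathbb C$ and $k,h:V\to(0,\infty)$ with $$\phi_1=\begin{pmatrix}0&\alpha\\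 \beta&0\end{pmatrix}dz,\quad H_1=\begin{pmatrix}k^{-1}&0\\0&k\end{pmatrix},\qquad \phi_2=\begin{pmatrix}0&\gamma\\ \delta&0\end{pmatrix}dz,\quad H_2=\begin{pmatrix}h^{-1}&0\\0&h\end{pmatrix},$$ and on $V$: (1) $g_1=4\alpha\beta\,dz^2+4(k^2|\beta|^2+k^{-2}|\alpha|^2)\,dz\,d\bar z+4\bar\alpha\bar\beta\,d\bar z^2$ and $g_2=4\gamma\delta\,dz^2+4(h^2|\delta|^2+h^{-2}|\gamma|^2)\,dz\,d\bar z+4\bar\gamma\bar\delta\,d\bar z^2$; (2) $\mathrm{Vol}(g_1)=4(k^{-2}|\alpha|^2-k^2|\beta|^2)\,dx\wedge dy$ and $\mathrm{Vol}(g_2)=4(h^{-2}|\gamma|^2-h^2|\delta|^2)\,dx\wedge dy$. Here $dz\,d\bar z$ is the symmetric product, so that $dz\,d\bar z=dx^2+dy^2$. -/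

import Mathlib

open scoped Manifold ContDiff UpperHalfPlane Matrix MatrixGroups ComplexConjugate

namespace HiggsSL2

noncomputable section

/-! ### Tensors on the tangent spaces of a surface -/

/-- A field of real bilinear forms on the (real) tangent spaces of a Riemann surface `M`,
i.e. a covariant `2`-tensor. -/
abbrev TwoTensor (M : Type*) [TopologicalSpace M] [ChartedSpace ℂ M] : Type _ :=
  ∀ x : M, LinearMap.BilinForm ℝ (TangentSpace 𝓘(ℝ, ℂ) x)

/-- The hyperbolic metric `(du² + dv²) / v²`, of curvature `-1`, of the upper half-plane
at the point `τ = u + i v`, as a bilinear form on `T_τ ℍ = ℂ`. -/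
def hyperbolicMetric (τ : ℍ) : LinearMap.BilinForm ℝ ℂ :=
  LinearMap.mk₂ ℝ (fun v w : ℂ => (v.re * w.re + v.im * w.im) / τ.im ^ 2)
    (by intros; simp; ring) (by intros; simp; ring)
    (by intros; simp; ring) (by intros; simp; ring)

/-- The hyperbolic area form `(du ∧ dv) / v²` of the upper half-plane at `τ = u + i v`. -/
def hyperbolicArea (τ : ℍ) : LinearMap.BilinForm ℝ ℂ :=
  LinearMap.mk₂ ℝ (fun v w : ℂ => (v.re * w.im - v.im * w.re) / τ.im ^ 2)
    (by intros; simp; ring) (by intros; simp; ring)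
    (by intros; simp; ring) (by intros; simp; ring)

section Surfaces

variable {X S : Type*} [TopologicalSpace X] [ChartedSpace ℂ X]
  [TopologicalSpace S] [ChartedSpace ℂ S]

/-- The (real) differential at `x` of a complex valued function on a Riemann surface. -/
def diff (f : X → ℂ) (x : X) : TangentSpace 𝓘(ℝ, ℂ) x →ₗ[ℝ] ℂ :=
  (mfderiv 𝓘(ℝ, ℂ) 𝓘(ℝ, ℂ) f x).toLinearMap

/-- The (real) differential at `x` of a map between Riemann surfaces. -/
def diffMap (p : X → S) (x : X) :
    TangentSpace 𝓘(ℝ, ℂ) x →ₗ[ℝ] TangentSpace 𝓘(ℝ, ℂ) (p x) :=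
  (mfderiv 𝓘(ℝ, ℂ) 𝓘(ℝ, ℂ) p x).toLinearMap

/-- The `2`-tensor `ψ^* g_ℍ`. -/
def pullbackMetric (ψ : X → ℍ) : TwoTensor X := fun x =>
  (hyperbolicMetric (ψ x)).comp (diff (fun y => (ψ y : ℂ)) x) (diff (fun y => (ψ y : ℂ)) x)

/-- The `2`-tensor `ψ^* Vol(g_ℍ)`. -/
def pullbackArea (ψ : X → ℍ) : TwoTensor X := fun x =>
  (hyperbolicArea (ψ x)).comp (diff (fun y => (ψ y : ℂ)) x) (diff (fun y => (ψ y : ℂ)) x)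

/-- The `2`-tensor `T` on `X` descends along `p : X → S` to the `2`-tensor `g` on `S`:
`p^* g = T`. -/
def Descends (p : X → S) (T : TwoTensor X) (g : TwoTensor S) : Prop :=
  ∀ x : X, (g (p x)).comp (diffMap p x) (diffMap p x) = T x

/-! ### Universal covering, equivariant harmonic maps -/

/-- `p : X → S` is a universal covering of the Riemann surface `S`, and `X` carries the
complex structure pulled back from `S`. -/
structure IsUniversalCovering (p : X → S) : Prop where
  simplyConnected : SimplyConnectedSpace X
  covering : IsCoveringMap p
  surjective : Function.Surjective p
  localBiholomorphism : IsLocalDiffeomorph 𝓘(ℂ) 𝓘(ℂ) ω p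

/-- The group of deck transformations of `p`. For a universal covering this is the
fundamental group of the base, acting on the universal cover. -/
def deckGroup (p : X → S) : Subgroup (X ≃ₜ X) where
  carrier := {γ | ∀ x, p (γ x) = p x}
  one_mem' := fun _ => rfl
  mul_mem' := fun {a b} ha hb x => (ha (b x)).trans (hb x)
  inv_mem' := fun {a} ha x => by
    have h := ha (a.symm x)
    rw [a.apply_symm_apply] at h
    exact h.symm

/-- `ψ` is equivariant for the representation `ρ` of the deck group in `SL(2, ℝ)`, which acts
on `ℍ` by Möbius transformations. -/
def IsEquivariant (p : X → S) (ρ : deckGroup p →* SL(2, ℝ)) (ψ : X → ℍ) : Prop :=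
  ∀ (γ : deckGroup p) (x : X), ψ (γ.1 x) = ρ γ • ψ x

/-- `ψ : X → ℍ` is a harmonic map from a Riemann surface to the hyperbolic plane: it is smooth
and its tension field vanishes. In a holomorphic coordinate `z = s + i t` of `X`, with
`u` the expression of `ψ`, the equation is `u_{z z̄} + (i / Im u) u_z u_{z̄} = 0`, that is
`(u_ss + u_tt) + (i / Im u) (u_s² + u_t²) = 0`. -/
def IsHarmonicMap (ψ : X → ℍ) : Prop :=
  ContMDiff 𝓘(ℝ, ℂ) 𝓘(ℝ, ℂ) ∞ (fun x => (ψ x : ℂ)) ∧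
  ∀ z ∈ atlas ℂ X, ∀ w ∈ z.target,
    let u : ℂ → ℂ := fun w' => (ψ (z.symm w') : ℂ)
    Laplacian.laplacian u w
      + Complex.I / ((u w).im : ℂ) * ((fderiv ℝ u w 1) ^ 2 + (fderiv ℝ u w Complex.I) ^ 2) = 0

/-! ### The harmonic metric, the Higgs field and the splitting

The complexified flat bundle `E^ℂ` is `(X × ℂ²) / π₁(S)`, with `γ · (x, v) = (γ x, ρ(γ) v)` and
the connection induced by `d`. Its sections over an open subset of `S` are the functions
`X → ℂ²` that are equivariant over that subset. -/

/-- The identification of `ℍ = SL(2, ℝ) / SO(2)` with the space of metrics of determinant one on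
`ℝ²`: the matrix of the metric at `τ` is `(g gᵀ)⁻¹` for any `g` in `SL(2, ℝ)` with `g • i = τ`;
equivalently the metric is `|v₀ - τ v₁|² / Im τ`. See `metricMatrix_I`, `metricMatrix_smul`. -/
def metricMatrix (τ : ℍ) : Matrix (Fin 2) (Fin 2) ℝ :=
  (1 / τ.im) • !![1, -τ.re; -τ.re, τ.re ^ 2 + τ.im ^ 2]

/-- A real matrix seen as a complex one. -/
abbrev cplx (A : Matrix (Fin 2) (Fin 2) ℝ) : Matrix (Fin 2) (Fin 2) ℂ :=
  A.map (fun r : ℝ => (r : ℂ))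

/-- The Hermitian metric on `ℂ²` at `τ` (antilinear in the first variable). -/
def hermMetric (τ : ℍ) (v w : Fin 2 → ℂ) : ℂ := star v ⬝ᵥ (cplx (metricMatrix τ) *ᵥ w)

/-- The complex bilinear extension to `ℂ²` of the real metric at `τ`. -/
def bilinMetric (τ : ℍ) (v w : Fin 2 → ℂ) : ℂ := v ⬝ᵥ (cplx (metricMatrix τ) *ᵥ w)

/-- The rotation by `+π/2` of the oriented plane `ℝ²` with the metric at `τ`: the complex
structure `J` with `det (v, J w) = H_τ (v, w)` for real vectors `v`, `w`. -/
def rotation (τ : ℍ) : Matrix (Fin 2) (Fin 2) ℝ := !![0, -1; 1, 0] * metricMatrix τ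

/-- The fiber of the line bundle `L` (the eigenvalue `-i` of the rotation). -/
def lineL (τ : ℍ) : Set (Fin 2 → ℂ) := {v | cplx (rotation τ) *ᵥ v = -Complex.I • v}

/-- The fiber of the line bundle `L⁻¹` (the eigenvalue `i` of the rotation). -/
def lineLinv (τ : ℍ) : Set (Fin 2 → ℂ) := {v | cplx (rotation τ) *ᵥ v = Complex.I • v}

/-- The self-adjoint part `Ψ = - (1/2) H⁻¹ dH` of the flat connection `d` with respect to the
Hermitian metric `H = ψ`; that is, `d = D_H + Ψ` with `D_H` a unitary connection. -/
def selfAdjointPart (ψ : X → ℍ) (x : X) (v : TangentSpace 𝓘(ℝ, ℂ) x) :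
    Matrix (Fin 2) (Fin 2) ℝ :=
  (-(1 / 2) : ℝ) • ((metricMatrix (ψ x))⁻¹ * Matrix.of fun i j =>
    (mfderiv 𝓘(ℝ, ℂ) 𝓘(ℝ, ℝ) (fun y => metricMatrix (ψ y) i j) x v : ℝ))

/-- The Higgs field `φ`, the `(1,0)`-part `φ(v) = (Ψ(v) - i Ψ(i v)) / 2` of `Ψ`. -/
def higgsField (ψ : X → ℍ) (x : X) (v : TangentSpace 𝓘(ℝ, ℂ) x) :
    Matrix (Fin 2) (Fin 2) ℂ :=
  (1 / 2 : ℂ) • (cplx (selfAdjointPart ψ x v)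
    - Complex.I • cplx (selfAdjointPart ψ x ((Complex.I • (show ℂ from v)))))

/-- A local section of the flat bundle `E^ℂ` over a subset `U` of `S`, as an equivariant
function over `U`. -/
def IsSectionOn (p : X → S) (ρ : deckGroup p →* SL(2, ℝ)) (U : Set S) (e : X → Fin 2 → ℂ) :
    Prop :=
  ∀ (γ : deckGroup p) (x : X), p x ∈ U → e (γ.1 x) = cplx (ρ γ).1 *ᵥ e x

/-- A frame of `E^ℂ` over `U` adapted to `E^ℂ = L ⊕ L⁻¹`: `e` is a section of `L` and `e'` is
the dual section of `L⁻¹` for the pairing given by the complex bilinear metric. No regularity is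
imposed, so smooth frames and holomorphic frames are included. -/
structure IsAdaptedFrame (p : X → S) (ρ : deckGroup p →* SL(2, ℝ)) (ψ : X → ℍ)
    (U : Set S) (e e' : X → Fin 2 → ℂ) : Prop where
  section_e : IsSectionOn p ρ U e
  section_e' : IsSectionOn p ρ U e'
  mem_L : ∀ x, p x ∈ U → e x ∈ lineL (ψ x)
  mem_Linv : ∀ x, p x ∈ U → e' x ∈ lineLinv (ψ x)
  dual : ∀ x, p x ∈ U → bilinMetric (ψ x) (e x) (e' x) = 1

/-- Over the domain of the coordinate `z` and in the frame `(e, e')`, the Hermitian metric is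
`diag(k⁻¹, k)` with `k > 0`, and the Higgs field is `(0, a; b, 0) dz`. -/
structure IsLocalExpression (p : X → S) (ψ : X → ℍ) (z : OpenPartialHomeomorph S ℂ)
    (e e' : X → Fin 2 → ℂ) (a b : S → ℂ) (k : S → ℝ) : Prop where
  pos : ∀ x ∈ z.source, 0 < k x
  metric_e : ∀ x, p x ∈ z.source → hermMetric (ψ x) (e x) (e x) = ((k (p x))⁻¹ : ℝ)
  metric_e' : ∀ x, p x ∈ z.source → hermMetric (ψ x) (e' x) (e' x) = (k (p x) : ℝ)
  orthogonal : ∀ x, p x ∈ z.source → hermMetric (ψ x) (e x) (e' x) = 0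
  higgs_e : ∀ x, p x ∈ z.source → ∀ v : TangentSpace 𝓘(ℝ, ℂ) x,
    higgsField ψ x v *ᵥ e x = (b (p x) * diff z (p x) (diffMap p x v)) • e' x
  higgs_e' : ∀ x, p x ∈ z.source → ∀ v : TangentSpace 𝓘(ℝ, ℂ) x,
    higgsField ψ x v *ᵥ e' x = (a (p x) * diff z (p x) (diffMap p x v)) • e x

/-- The value on `(v, w)` of `dz²` at `x`. -/
def dzdz (z : S → ℂ) (x : S) (v w : TangentSpace 𝓘(ℝ, ℂ) x) : ℂ :=
  diff z x v * diff z x w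

/-- The value on `(v, w)` of the symmetric product `dz dz̄` at `x`. -/
def dzdzbar (z : S → ℂ) (x : S) (v w : TangentSpace 𝓘(ℝ, ℂ) x) : ℂ :=
  (1 / 2) * (diff z x v * conj (diff z x w) + conj (diff z x v) * diff z x w)

/-- The value on `(v, w)` of `dz̄²` at `x`. -/
def dzbardzbar (z : S → ℂ) (x : S) (v w : TangentSpace 𝓘(ℝ, ℂ) x) : ℂ :=
  conj (diff z x v) * conj (diff z x w)

/-- The value on `(v, w)` of `dx ∧ dy` at a point, where `z = x + i y`. -/
def dxwedgedy (z : S → ℂ) (x : S) (v w : TangentSpace 𝓘(ℝ, ℂ) x) : ℝ :=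
  (diff z x v).re * (diff z x w).im - (diff z x v).im * (diff z x w).re

end Surfaces

/-! ### Sanity checks on the identification of `ℍ` with the space of metrics -/

theorem metricMatrix_I : metricMatrix UpperHalfPlane.I = 1 := by
  ext i j
  fin_cases i <;> fin_cases j <;> simp [metricMatrix, UpperHalfPlane.I]

theorem metricMatrix_smul (g : SL(2, ℝ)) (τ : ℍ) :
    g.1ᵀ * metricMatrix (g • τ) * g.1 = metricMatrix τ := by
  have hd := g.2
  rw [Matrix.det_fin_two] at hd
  have hτ := τ.im_pos
  have hz : ((g • τ : ℍ) : ℂ) = ((g.1 0 0 : ℂ) * τ + g.1 0 1) / ((g.1 1 0 : ℂ) * τ + g.1 1 1) :=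
    UpperHalfPlane.coe_specialLinearGroup_apply g τ
  obtain ⟨a, b, c, d, ha, hb, hc, hdd⟩ : ∃ a b c d : ℝ,
    g.1 0 0 = a ∧ g.1 0 1 = b ∧ g.1 1 0 = c ∧ g.1 1 1 = d := ⟨_, _, _, _, rfl, rfl, rfl, rfl⟩
  have hre := congrArg Complex.re hz
  have him := congrArg Complex.im hz
  rw [ha, hb, hc, hdd] at hd hre him
  simp only [Complex.div_re, Complex.div_im, Complex.normSq_apply, Complex.add_re, Complex.add_im,
    Complex.mul_re, Complex.mul_im, Complex.ofReal_re, Complex.ofReal_im, UpperHalfPlane.coe_re,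
    UpperHalfPlane.coe_im, zero_mul, sub_zero, add_zero] at hre him
  set u := τ.re with hu
  set v := τ.im with hv
  have hD : 0 < (c * u + d) * (c * u + d) + c * v * (c * v) := by
    by_cases h0 : c = 0
    · subst h0
      have : d ≠ 0 := by rintro rfl; simp at hd
      simp only [zero_mul, zero_add, add_zero]
      exact mul_self_pos.2 this
    · have : c * v ≠ 0 := mul_ne_zero h0 hτ.ne'
      nlinarith [mul_self_nonneg (c * u + d), mul_self_pos.2 this]
  set D := (c * u + d) * (c * u + d) + c * v * (c * v) with hDD
  have him' : (g • τ).im = v / D := by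
    rw [him, ← sub_div]
    congr 1
    linear_combination v * hd
  have hre' : (g • τ).re = ((a * u + b) * (c * u + d) + a * c * v ^ 2) / D := by
    rw [hre, ← add_div]
    congr 1
    ring
  have hsq : (g • τ).re ^ 2 + (g • τ).im ^ 2 = ((a * u + b) ^ 2 + a ^ 2 * v ^ 2) / D := by
    rw [him', hre', div_pow, div_pow, ← add_div, div_eq_div_iff (by positivity) hD.ne', hDD]
    have hb' : 1 = (a * d - b * c) ^ 2 := by rw [hd]; ring
    linear_combination ((c * u + d) * (c * u + d) + c * v * (c * v)) * v ^ 2 * hb'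
  have hM : metricMatrix (g • τ) = (1 / v) • !![D, -((a * u + b) * (c * u + d) + a * c * v ^ 2);
      -((a * u + b) * (c * u + d) + a * c * v ^ 2), (a * u + b) ^ 2 + a ^ 2 * v ^ 2] := by
    unfold metricMatrix
    rw [hsq, him', hre']
    ext i j
    fin_cases i <;> fin_cases j <;> simp <;> field_simp <;> ring
  have hg : g.1 = !![a, b; c, d] := by
    rw [← ha, ← hb, ← hc, ← hdd]; exact Matrix.eta_fin_two _
  have hb' : (a * d - b * c) ^ 2 = 1 := by rw [hd]; ring
  rw [hM, hg]
  unfold metricMatrix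
  rw [Matrix.mul_smul, Matrix.smul_mul, ← hu, ← hv]
  congr 1
  ext i j
  fin_cases i <;> fin_cases j <;> simp [Matrix.mul_apply, Fin.sum_univ_two, hDD]
  · linear_combination hb'
  · linear_combination -u * hb'
  · linear_combination -u * hb'
  · linear_combination (u ^ 2 + v ^ 2) * hb'

end

end HiggsSL2

/-! Everything reduces to linear algebra at one point `τ = ψ x` of `ℍ`, with `t = Im τ`. The
eigenline `L` is spanned by `(τ̄, 1)` and `L⁻¹` by `(τ, 1)`. Since `det H = 1`, the `H`-symmetric
endomorphism `Ψ = -(1/2) H⁻¹ dH` is trace-free, so it anticommutes with the rotation and exchanges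
the two lines: for a tangent vector `d` of `ℍ`, it sends `(τ, 1)` to `(i d / 2t) (τ̄, 1)` and `(τ̄,
1)` to `(-i d̄ / 2t) (τ, 1)`.

Write the differential of `ψ` in charts as `v ↦ A v + B v̄`. Taking `(1,0)`-parts keeps `A` in the
first coefficient and `B̄` in the second. So `α` measures `∂ψ` and `β` the conjugate of `∂̄ψ`. On
the other side, `ψ^* g_ℍ` is `|A v + B v̄|² / t²`, with coefficients `A B̄`, `|A|² + |B|²` and `Ā
B`, and the area form is `(|A|² - |B|²) / t²` times the standard one.

An adapted frame is `e = e₁ (τ̄, 1)`, `e' = e'₁ (τ, 1)`, and duality says `2t e₁ e'₁ = 1`. Hence `k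
= 2t |e'₁|²`, `α = i e'₁² A / q` and `β = -i e₁² B̄ / q`, where `q` is the derivative of `z ∘ p`. In
`αβ`, `k⁻² |α|²` and `k² |β|²` the frame cancels, leaving exactly the coefficients above
(`higgsAlpha_mul_higgsBeta`, `norm_higgsAlpha`, `norm_higgsBeta`).

Descent to `S` rests on the factor of automorphy `j = cτ + d`: a matrix `g` sends `(τ, 1)` to `j
(gτ, 1)` and the derivative of its Möbius map is `j⁻²`. These weights cancel in `α`, `β`, `k` and in
both tensors, and the deck group is transitive on the fibers of `p`. -/

namespace HiggsSL2

/-! ### Complex derivatives of holomorphic maps, and deck transformations. -/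

section Calculus

variable {X S : Type*} [TopologicalSpace X] [ChartedSpace ℂ X]
  [TopologicalSpace S] [ChartedSpace ℂ S]

/-- A complex differentiable map between Riemann surfaces is real differentiable, and its real
differential is the multiplication by a complex number in the preferred charts. -/
theorem exists_hasMFDerivAt_real {f : X → S} {x : X} (hf : MDifferentiableAt 𝓘(ℂ) 𝓘(ℂ) f x) :
    ∃ c : ℂ, HasMFDerivAt 𝓘(ℝ, ℂ) 𝓘(ℝ, ℂ) f x
      (ContinuousLinearMap.restrictScalars ℝ (c • ContinuousLinearMap.id ℂ ℂ) : ℂ →L[ℝ] ℂ) := by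
  obtain ⟨hcont, hderiv⟩ := hf.hasMFDerivAt
  obtain ⟨L, hL⟩ : ∃ L : ℂ →L[ℂ] ℂ, L = mfderiv 𝓘(ℂ) 𝓘(ℂ) f x := ⟨_, rfl⟩
  rw [← hL] at hderiv
  have h1 : ContinuousLinearMap.restrictScalars ℝ (L 1 • ContinuousLinearMap.id ℂ ℂ) =
      L.restrictScalars ℝ := ContinuousLinearMap.ext fun v => by
    change L 1 * v = L v
    rw [mul_comm, ← smul_eq_mul, ← map_smul, smul_eq_mul, mul_one]
  refine ⟨L 1, hcont, ?_⟩
  rw [h1]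
  -- The real and the complex manifold derivatives concern the same function read in the same
  -- charts, so only the scalars change.
  exact HasFDerivWithinAt.restrictScalars ℝ hderiv

/-- The chain rule, used to see that the derivatives of `p` and of a holomorphic coordinate do not
vanish. -/
theorem mul_eq_one_of_leftInverse {f : X → S} {g : S → X} {x : X} {c d : ℂ}
    (hf : HasMFDerivAt 𝓘(ℝ, ℂ) 𝓘(ℝ, ℂ) f x
      (ContinuousLinearMap.restrictScalars ℝ (c • ContinuousLinearMap.id ℂ ℂ) : ℂ →L[ℝ] ℂ))
    (hg : HasMFDerivAt 𝓘(ℝ, ℂ) 𝓘(ℝ, ℂ) g (f x)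
      (ContinuousLinearMap.restrictScalars ℝ (d • ContinuousLinearMap.id ℂ ℂ) : ℂ →L[ℝ] ℂ))
    (hgf : g ∘ f =ᶠ[nhds x] id) : d * c = 1 := by
  have h1 := (hg.comp x hf).congr_of_eventuallyEq hgf.symm
  have h2 := hasMFDerivAt_unique h1 (hasMFDerivAt_id x)
  have h3 : d * (c * 1) = 1 := DFunLike.congr_fun h2 (1 : ℂ)
  simpa using h3

theorem diffMap_eq_of_hasMFDerivAt {f : X → S} {x : X} {c : ℂ}
    (h : HasMFDerivAt 𝓘(ℝ, ℂ) 𝓘(ℝ, ℂ) f x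
      (ContinuousLinearMap.restrictScalars ℝ (c • ContinuousLinearMap.id ℂ ℂ) : ℂ →L[ℝ] ℂ))
    (v : ℂ) : (diffMap f x v : ℂ) = c * v := by
  unfold diffMap
  rw [h.mfderiv]
  rfl

theorem IsUniversalCovering.exists_hasMFDerivAt_mul {p : X → S} (hp : IsUniversalCovering p) (x : X) :
    ∃ c : ℂ, c ≠ 0 ∧ HasMFDerivAt 𝓘(ℝ, ℂ) 𝓘(ℝ, ℂ) p x
      (ContinuousLinearMap.restrictScalars ℝ (c • ContinuousLinearMap.id ℂ ℂ) : ℂ →L[ℝ] ℂ) := by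
  have hl := hp.localBiholomorphism x
  have hω : (ω : WithTop ℕ∞) ≠ 0 := by simp
  obtain ⟨c, hc⟩ := exists_hasMFDerivAt_real (hl.mdifferentiableAt hω)
  obtain ⟨d, hd⟩ := exists_hasMFDerivAt_real (hl.localInverse_mdifferentiableAt hω)
  refine ⟨c, ?_, hc⟩
  exact right_ne_zero_of_mul_eq_one
    (mul_eq_one_of_leftInverse hc hd hl.localInverse_eventuallyEq_left)

theorem exists_diff_chart_eq_mul [IsManifold 𝓘(ℂ) ω S] {z : OpenPartialHomeomorph S ℂ}
    (hz : z ∈ IsManifold.maximalAtlas 𝓘(ℂ) ω S) {s : S} (hs : s ∈ z.source) :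
    ∃ c : ℂ, c ≠ 0 ∧ ∀ v : ℂ, diff z s v = c * v := by
  have hω : (ω : WithTop ℕ∞) ≠ 0 := by simp
  obtain ⟨c, hc⟩ := exists_hasMFDerivAt_real
    ((contMDiffAt_of_mem_maximalAtlas hz hs).mdifferentiableAt hω)
  obtain ⟨d, hd⟩ := exists_hasMFDerivAt_real
    ((contMDiffAt_symm_of_mem_maximalAtlas hz (z.map_source hs)).mdifferentiableAt hω)
  refine ⟨c, ?_, fun v => diffMap_eq_of_hasMFDerivAt hc v⟩
  exact right_ne_zero_of_mul_eq_one
    (mul_eq_one_of_leftInverse hc hd (z.eventually_left_inverse hs))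

/-- The deck group of a universal covering acts transitively on the fibers. -/
theorem IsUniversalCovering.exists_deckGroup_apply_eq {p : X → S} (hp : IsUniversalCovering p)
    {x y : X} (h : p x = p y) : ∃ γ : deckGroup p, γ.1 x = y := by
  have := hp.simplyConnected
  have : LocallyPathConnectedSpace X := ChartedSpace.locallyPathConnectedSpace ℂ X
  let f : C(X, S) := ⟨p, hp.covering.continuous⟩
  -- `F` lifts `p` through `p` itself with `x ↦ y`, and `G` does so with `y ↦ x`. Both composites
  -- lift `p` and fix a point, so uniqueness of lifts makes them the identity.
  obtain ⟨F, ⟨hF, hpF⟩, -⟩ := hp.covering.existsUnique_continuousMap_lifts f x y h.symm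
  obtain ⟨G, ⟨hG, hpG⟩, -⟩ := hp.covering.existsUnique_continuousMap_lifts f y x h
  have hF' : ∀ a, p (F a) = p a := fun a => congrFun hpF a
  have hG' : ∀ a, p (G a) = p a := fun a => congrFun hpG a
  have hGF : G ∘ F = id := hp.covering.eq_of_comp_eq (by fun_prop) continuous_id
    (funext fun a => by simp [hF', hG']) x (by simp [hF, hG])
  have hFG : F ∘ G = id := hp.covering.eq_of_comp_eq (by fun_prop) continuous_id
    (funext fun a => by simp [hF', hG']) y (by simp [hF, hG])
  exact ⟨⟨⟨⟨F, G, congrFun hGF, congrFun hFG⟩, F.continuous, G.continuous⟩, hF'⟩, hF⟩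

/-- Deck transformations are holomorphic. -/
theorem IsUniversalCovering.exists_hasMFDerivAt_deck {p : X → S} (hp : IsUniversalCovering p)
    (γ : deckGroup p) (x : X) : ∃ m : ℂ, HasMFDerivAt 𝓘(ℝ, ℂ) 𝓘(ℝ, ℂ) γ.1 x
      (ContinuousLinearMap.restrictScalars ℝ (m • ContinuousLinearMap.id ℂ ℂ) : ℂ →L[ℝ] ℂ) := by
  have hω : (ω : WithTop ℕ∞) ≠ 0 := by simp
  have hl := hp.localBiholomorphism (γ.1 x)
  have hpx : p (γ.1 x) = p x := γ.2 x
  have hinv := hl.localInverse_mdifferentiableAt hω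
  rw [hpx] at hinv
  apply exists_hasMFDerivAt_real
  -- Near `x`, `γ` is `p` followed by the local inverse of `p` at `γ x`.
  refine (hinv.comp x ((hp.localBiholomorphism x).mdifferentiableAt hω)).congr_of_eventuallyEq ?_
  have := γ.1.continuous.continuousAt.eventually hl.localInverse_eventuallyEq_left
  filter_upwards [this] with a ha
  have hpa : p (γ.1 a) = p a := γ.2 a
  simpa [hpa] using ha.symm

end Calculus

/-! ### The self-adjoint part and the Higgs field on the vectors `(τ, 1)` and `(τ̄, 1)`. -/

section HiggsField

variable {X : Type*} [TopologicalSpace X] [ChartedSpace ℂ X]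

theorem IsHarmonicMap.hasMFDerivAt {ψ : X → ℍ} (h : IsHarmonicMap ψ) (x : X) :
    HasMFDerivAt 𝓘(ℝ, ℂ) 𝓘(ℝ, ℂ) (fun y => (ψ y : ℂ)) x
      (mfderiv 𝓘(ℝ, ℂ) 𝓘(ℝ, ℂ) (fun y => (ψ y : ℂ)) x) :=
  (h.1.mdifferentiableAt (by simp)).hasMFDerivAt

/-- The derivative of the entries of `metricMatrix` in the upper half-plane. -/
theorem exists_hasFDerivAt_metricMatrix (τ : ℍ) (i j : Fin 2) :
    ∃ (F : ℂ → ℝ) (F' : ℂ →L[ℝ] ℝ), (∀ σ : ℍ, metricMatrix σ i j = F σ) ∧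
      HasFDerivAt F F' τ ∧ ∀ d : ℂ, F' d =
        !![-d.im / τ.im ^ 2, -d.re / τ.im + τ.re * d.im / τ.im ^ 2;
          -d.re / τ.im + τ.re * d.im / τ.im ^ 2,
          -τ.re ^ 2 * d.im / τ.im ^ 2 + d.im + 2 * τ.re * d.re / τ.im] i j := by
  have hτ : (τ : ℂ).im ≠ 0 := τ.im_ne_zero
  have hre : HasFDerivAt Complex.re Complex.reCLM (τ : ℂ) := Complex.reCLM.hasFDerivAt
  have him : HasFDerivAt Complex.im Complex.imCLM (τ : ℂ) := Complex.imCLM.hasFDerivAt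
  have hinv := (hasDerivAt_inv hτ).comp_hasFDerivAt (τ : ℂ) him
  have h01 : ∃ (F : ℂ → ℝ) (F' : ℂ →L[ℝ] ℝ), (∀ σ : ℍ, σ.im⁻¹ * -σ.re = F σ) ∧
      HasFDerivAt F F' τ ∧ ∀ d : ℂ, F' d = -d.re / τ.im + τ.re * d.im / τ.im ^ 2 := by
    refine ⟨_, _, fun σ => rfl, hinv.mul hre.neg, fun d => ?_⟩
    simp
    field_simp
  fin_cases i <;> fin_cases j
  · refine ⟨_, _, fun σ => ?_, hinv, fun d => ?_⟩
    · simp [metricMatrix]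
    · simp
      field_simp
  · simpa [metricMatrix] using h01
  · simpa [metricMatrix] using h01
  · refine ⟨_, _, fun σ => ?_, hinv.mul ((hre.pow 2).add (him.pow 2)), fun d => ?_⟩
    · simp [metricMatrix]
    · simp
      have := τ.im_ne_zero
      field_simp
      ring

/-- The value at `τ` of the endomorphism `-(1/2) H⁻¹ dH` on a tangent vector `d` of `ℍ`. -/
noncomputable def selfAdjointMatrix (τ : ℍ) (d : ℂ) : Matrix (Fin 2) (Fin 2) ℝ :=
  (1 / (2 * τ.im ^ 2)) •
    !![d.im * τ.im + τ.re * d.re, d.re * τ.im ^ 2 - 2 * τ.re * d.im * τ.im - τ.re ^ 2 * d.re;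
      d.re, -(d.im * τ.im + τ.re * d.re)]

theorem selfAdjointPart_eq {ψ : X → ℍ} (h : IsHarmonicMap ψ) (x : X)
    (v : TangentSpace 𝓘(ℝ, ℂ) x) :
    selfAdjointPart ψ x v =
      selfAdjointMatrix (ψ x) (diff (fun y => (ψ y : ℂ)) x v) := by
  set u := (ψ x).re with hu
  set t := (ψ x).im with ht'
  set d := diff (fun y => (ψ y : ℂ)) x v
  have ht : t ≠ 0 := (ψ x).im_ne_zero
  have hinv : (metricMatrix (ψ x))⁻¹ = (1 / t) • !![u ^ 2 + t ^ 2, u; u, 1] := by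
    apply Matrix.inv_eq_left_inv
    change (1 / t) • !![u ^ 2 + t ^ 2, u; u, 1] * (1 / t) • !![1, -u; -u, u ^ 2 + t ^ 2] = 1
    ext i j
    fin_cases i <;> fin_cases j <;> simp <;> field_simp <;> ring
  have hd : (Matrix.of fun i j =>
      (mfderiv 𝓘(ℝ, ℂ) 𝓘(ℝ, ℝ) (fun y => metricMatrix (ψ y) i j) x v : ℝ)) =
      !![-d.im / t ^ 2, -d.re / t + u * d.im / t ^ 2;
          -d.re / t + u * d.im / t ^ 2,
          -u ^ 2 * d.im / t ^ 2 + d.im + 2 * u * d.re / t] := by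
    ext i j
    obtain ⟨F, F', hF, hF', hval⟩ := exists_hasFDerivAt_metricMatrix (ψ x) i j
    have h1 := HasMFDerivAt.comp x (HasFDerivAt.hasMFDerivAt hF') (h.hasMFDerivAt x)
    have h2 : (fun y => metricMatrix (ψ y) i j) = F ∘ fun y => (ψ y : ℂ) :=
      funext fun y => hF (ψ y)
    rw [← h2] at h1
    exact (DFunLike.congr_fun h1.mfderiv v).trans (hval d)
  rw [selfAdjointPart, selfAdjointMatrix, hinv, hd, ← hu, ← ht']
  ext i j
  fin_cases i <;> fin_cases j <;> simp <;> field_simp <;> ring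

/-- The complex linear part of the differential of `ψ` in the preferred chart. -/
noncomputable def linearPart (ψ : X → ℍ) (x : X) : ℂ :=
  (1 / 2) * (diff (fun y => (ψ y : ℂ)) x (1 : ℂ)
    - Complex.I * diff (fun y => (ψ y : ℂ)) x Complex.I)

/-- The complex antilinear part of the differential of `ψ` in the preferred chart. -/
noncomputable def antilinearPart (ψ : X → ℍ) (x : X) : ℂ :=
  (1 / 2) * (diff (fun y => (ψ y : ℂ)) x (1 : ℂ)
    + Complex.I * diff (fun y => (ψ y : ℂ)) x Complex.I)

/-- From here on the differential of `ψ` is carried by two complex numbers, `A = linearPart ψ x` and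
`B = antilinearPart ψ x`. -/
theorem diff_eq_linearPart_add (ψ : X → ℍ) (x : X) (v : ℂ) :
    diff (fun y => (ψ y : ℂ)) x v = linearPart ψ x * v + antilinearPart ψ x * conj v := by
  let D : ℂ →ₗ[ℝ] ℂ := diff (fun y => (ψ y : ℂ)) x
  have h : D v = v.re * D 1 + v.im * D Complex.I := by
    rw [← Complex.real_smul, ← Complex.real_smul, ← map_smul, ← map_smul, ← map_add]
    simp
  change D v = (1 / 2) * (D 1 - Complex.I * D Complex.I) * v +
    (1 / 2) * (D 1 + Complex.I * D Complex.I) * conj v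
  rw [h]
  apply Complex.ext <;> simp <;> ring

/-- A trace-free endomorphism symmetric for the metric anticommutes with the rotation, hence
exchanges its eigenlines. The coefficient is complex linear in `d` here and antilinear on the
conjugate line. -/
theorem selfAdjointMatrix_mulVec_coe (τ : ℍ) (d : ℂ) :
    cplx (selfAdjointMatrix τ d) *ᵥ ![(τ : ℂ), 1] =
      (Complex.I / (2 * τ.im) * d) • ![conj (τ : ℂ), 1] := by
  have ht : (τ.im : ℂ) ≠ 0 := by exact_mod_cast τ.im_ne_zero
  have hτ : (τ : ℂ) = τ.re + τ.im * Complex.I := (Complex.re_add_im _).symm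
  have hd : d = d.re + d.im * Complex.I := (Complex.re_add_im d).symm
  generalize d.re = a, d.im = b at hd
  subst hd
  rw [hτ]
  ext i
  fin_cases i <;> simp [selfAdjointMatrix, Matrix.mulVec, dotProduct, Fin.sum_univ_two] <;>
    field_simp
  · linear_combination (-(τ.im : ℂ) * b * τ.re + τ.im ^ 2 * b * Complex.I + τ.im ^ 2 * a) *
      Complex.I_sq
  · linear_combination (-(τ.im : ℂ) * b) * Complex.I_sq

/-- The matrix is real, so this is the complex conjugate of `selfAdjointMatrix_mulVec_coe`. -/
theorem selfAdjointMatrix_mulVec_conj (τ : ℍ) (d : ℂ) :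
    cplx (selfAdjointMatrix τ d) *ᵥ ![conj (τ : ℂ), 1] =
      (-Complex.I / (2 * τ.im) * conj d) • ![(τ : ℂ), 1] := by
  have h := selfAdjointMatrix_mulVec_coe τ d
  ext i
  have hi := congrArg conj (congrFun h i)
  fin_cases i <;> simpa [Matrix.mulVec, dotProduct, Complex.conj_ofNat] using hi

theorem higgsField_eq {ψ : X → ℍ} (h : IsHarmonicMap ψ) (x : X) (v : ℂ) :
    higgsField ψ x v = (1 / 2 : ℂ) •
      (cplx (selfAdjointMatrix (ψ x) (linearPart ψ x * v + antilinearPart ψ x * conj v)) -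
        Complex.I • cplx (selfAdjointMatrix (ψ x)
          (linearPart ψ x * (Complex.I * v) + antilinearPart ψ x * conj (Complex.I * v)))) := by
  rw [← diff_eq_linearPart_add, ← diff_eq_linearPart_add]
  exact congrArg₂ (fun A B => (1 / 2 : ℂ) • (cplx A - Complex.I • cplx B))
    (selfAdjointPart_eq h x v) (selfAdjointPart_eq h x (Complex.I * v : ℂ))

/-- The coefficient of `Ψ` involves the conjugate of `A v + B v̄`, that is `Ā v̄ + B̄ v`. The
projection `f(v) ↦ (f(v) - i f(iv)) / 2` keeps its complex linear term `B̄ v`. -/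
theorem higgsField_mulVec_conj {ψ : X → ℍ} (h : IsHarmonicMap ψ) (x : X) (v : ℂ) :
    higgsField ψ x v *ᵥ ![conj (ψ x : ℂ), 1] =
      (-Complex.I / (2 * (ψ x).im) * (conj (antilinearPart ψ x) * v)) • ![(ψ x : ℂ), 1] := by
  rw [higgsField_eq h, Matrix.smul_mulVec, Matrix.sub_mulVec, Matrix.smul_mulVec,
    selfAdjointMatrix_mulVec_conj, selfAdjointMatrix_mulVec_conj, smul_smul, ← sub_smul, smul_smul]
  congr 1
  simp
  linear_combination (1 / 4) * Complex.I / ((ψ x).im : ℂ) *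
    (-conj (linearPart ψ x) * conj v + conj (antilinearPart ψ x) * v) * Complex.I_sq

/-- The same projection, applied to `A v + B v̄`, keeps `A v`. -/
theorem higgsField_mulVec_coe {ψ : X → ℍ} (h : IsHarmonicMap ψ) (x : X) (v : ℂ) :
    higgsField ψ x v *ᵥ ![(ψ x : ℂ), 1] =
      (Complex.I / (2 * (ψ x).im) * (linearPart ψ x * v)) • ![conj (ψ x : ℂ), 1] := by
  rw [higgsField_eq h, Matrix.smul_mulVec, Matrix.sub_mulVec, Matrix.smul_mulVec,
    selfAdjointMatrix_mulVec_coe, selfAdjointMatrix_mulVec_coe, smul_smul, ← sub_smul, smul_smul]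
  congr 1
  simp
  linear_combination (1 / 4) * Complex.I / ((ψ x).im : ℂ) *
    (antilinearPart ψ x * conj v - linearPart ψ x * v) * Complex.I_sq

end HiggsField

/-! ### The eigenlines of the rotation and the metrics on them. -/

section Lines

theorem eq_smul_of_mem_lineL {τ : ℍ} {v : Fin 2 → ℂ} (hv : v ∈ lineL τ) :
    v = v 1 • ![conj (τ : ℂ), 1] := by
  have ht : (τ.im : ℂ) ≠ 0 := by exact_mod_cast τ.im_ne_zero
  -- The second row of the eigenvector equation alone gives `v 0 = τ̄ * v 1`.
  have h1 := congrFun hv 1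
  have hτ : (τ : ℂ) = τ.re + τ.im * Complex.I := (Complex.re_add_im _).symm
  simp [rotation, metricMatrix, Matrix.mulVec, dotProduct, Fin.sum_univ_two] at h1
  field_simp at h1
  ext i
  fin_cases i
  · simp [hτ]
    linear_combination h1
  · simp

theorem eq_smul_of_mem_lineLinv {τ : ℍ} {v : Fin 2 → ℂ} (hv : v ∈ lineLinv τ) :
    v = v 1 • ![(τ : ℂ), 1] := by
  have ht : (τ.im : ℂ) ≠ 0 := by exact_mod_cast τ.im_ne_zero
  have h1 := congrFun hv 1
  have hτ : (τ : ℂ) = τ.re + τ.im * Complex.I := (Complex.re_add_im _).symm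
  simp [rotation, metricMatrix, Matrix.mulVec, dotProduct, Fin.sum_univ_two] at h1
  field_simp at h1
  ext i
  fin_cases i
  · simp [hτ]
    linear_combination h1
  · simp

theorem bilinMetric_smul_smul (τ : ℍ) (c c' : ℂ) :
    bilinMetric τ (c • ![conj (τ : ℂ), 1]) (c' • ![(τ : ℂ), 1]) = 2 * τ.im * (c * c') := by
  have ht : (τ.im : ℂ) ≠ 0 := by exact_mod_cast τ.im_ne_zero
  have hτ : (τ : ℂ) = τ.re + τ.im * Complex.I := (Complex.re_add_im _).symm
  simp [bilinMetric, metricMatrix, Matrix.mulVec, dotProduct, Fin.sum_univ_two, hτ]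
  field_simp
  linear_combination (-c * c' * τ.im ^ 2) * Complex.I_sq

theorem hermMetric_conj_conj (τ : ℍ) (c : ℂ) :
    hermMetric τ (c • ![conj (τ : ℂ), 1]) (c • ![conj (τ : ℂ), 1]) = (‖c‖ ^ 2 * (2 * τ.im) : ℝ) := by
  have ht : (τ.im : ℂ) ≠ 0 := by exact_mod_cast τ.im_ne_zero
  have hτ : (τ : ℂ) = τ.re + τ.im * Complex.I := (Complex.re_add_im _).symm
  have hc := Complex.conj_mul' c
  simp [hermMetric, metricMatrix, Matrix.mulVec, dotProduct, Fin.sum_univ_two, hτ]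
  rw [← hc]
  field_simp
  linear_combination (-c * conj c * τ.im ^ 2) * Complex.I_sq

theorem hermMetric_coe_coe (τ : ℍ) (c : ℂ) :
    hermMetric τ (c • ![(τ : ℂ), 1]) (c • ![(τ : ℂ), 1]) = (‖c‖ ^ 2 * (2 * τ.im) : ℝ) := by
  have ht : (τ.im : ℂ) ≠ 0 := by exact_mod_cast τ.im_ne_zero
  have hτ : (τ : ℂ) = τ.re + τ.im * Complex.I := (Complex.re_add_im _).symm
  have hc := Complex.conj_mul' c
  simp [hermMetric, metricMatrix, Matrix.mulVec, dotProduct, Fin.sum_univ_two, hτ]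
  rw [← hc]
  field_simp
  linear_combination (-c * conj c * τ.im ^ 2) * Complex.I_sq

theorem hermMetric_conj_coe (τ : ℍ) (c c' : ℂ) :
    hermMetric τ (c • ![conj (τ : ℂ), 1]) (c' • ![(τ : ℂ), 1]) = 0 := by
  have ht : (τ.im : ℂ) ≠ 0 := by exact_mod_cast τ.im_ne_zero
  have hτ : (τ : ℂ) = τ.re + τ.im * Complex.I := (Complex.re_add_im _).symm
  simp [hermMetric, metricMatrix, Matrix.mulVec, dotProduct, Fin.sum_univ_two, hτ]
  field_simp
  linear_combination (c' * conj c * τ.im ^ 2) * Complex.I_sq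

end Lines

/-! ### Factors of automorphy and invariance of the pulled-back tensors. -/

section Equivariance

variable {X S : Type*} [TopologicalSpace X] [ChartedSpace ℂ X]

/-- The factor of automorphy `cτ + d`. -/
noncomputable def autFactor (g : SL(2, ℝ)) (τ : ℍ) : ℂ := (g.1 1 0 : ℂ) * τ + g.1 1 1

theorem autFactor_ne_zero (g : SL(2, ℝ)) (τ : ℍ) : autFactor g τ ≠ 0 := by
  intro h
  have hd := g.2
  rw [Matrix.det_fin_two] at hd
  have him := congrArg Complex.im h
  have hre := congrArg Complex.re h
  simp [autFactor, τ.im_ne_zero] at him hre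
  simp [him] at hre
  simp [him, hre] at hd

theorem coe_smul_eq_div_autFactor (g : SL(2, ℝ)) (τ : ℍ) :
    ((g • τ : ℍ) : ℂ) = ((g.1 0 0 : ℂ) * τ + g.1 0 1) / autFactor g τ :=
  UpperHalfPlane.coe_specialLinearGroup_apply g τ

theorem im_smul_eq_div_normSq_autFactor (g : SL(2, ℝ)) (τ : ℍ) :
    (g • τ).im = τ.im / Complex.normSq (autFactor g τ) := by
  have hd := g.2
  rw [Matrix.det_fin_two] at hd
  have h := congrArg Complex.im (coe_smul_eq_div_autFactor g τ)
  rw [UpperHalfPlane.coe_im, Complex.div_im, ← sub_div] at h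
  rw [h]
  congr 1
  simp [autFactor]
  linear_combination τ.im * hd

/-- The numerator of the derivative is `ad - bc = 1`. The function `F` extends the Möbius map to a
function on `ℂ`, where the chain rule can be applied. -/
theorem exists_hasFDerivAt_moebius (g : SL(2, ℝ)) (τ : ℍ) :
    ∃ F : ℂ → ℂ, (∀ σ : ℍ, ((g • σ : ℍ) : ℂ) = F σ) ∧ HasFDerivAt F
      (ContinuousLinearMap.restrictScalars ℝ
        (((autFactor g τ) ^ 2)⁻¹ • ContinuousLinearMap.id ℂ ℂ) : ℂ →L[ℝ] ℂ) τ := by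
  refine ⟨fun w => ((g.1 0 0 : ℂ) * w + g.1 0 1) / ((g.1 1 0 : ℂ) * w + g.1 1 1),
    coe_smul_eq_div_autFactor g, ?_⟩
  have hj := autFactor_ne_zero g τ
  have hd : ((g.1 0 0 : ℂ) * g.1 1 1 - g.1 0 1 * g.1 1 0) = 1 := by
    have := g.2
    rw [Matrix.det_fin_two] at this
    exact_mod_cast this
  have h := (((hasDerivAt_id (τ : ℂ)).const_mul (g.1 0 0 : ℂ)).add_const (g.1 0 1 : ℂ)).div
    (((hasDerivAt_id (τ : ℂ)).const_mul (g.1 1 0 : ℂ)).add_const (g.1 1 1 : ℂ)) hj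
  refine (h.hasFDerivAt.restrictScalars ℝ).congr_fderiv (ContinuousLinearMap.ext fun v => ?_)
  simp only [autFactor] at hj ⊢
  simp
  field_simp
  linear_combination v * hd

/-- The differential of an equivariant map at two points related by a deck transformation. -/
theorem diff_deck {p : X → S} {ρ : deckGroup p →* SL(2, ℝ)} {ψ : X → ℍ}
    (hequiv : IsEquivariant p ρ ψ) (hharm : IsHarmonicMap ψ) (γ : deckGroup p) (x : X) {m : ℂ}
    (hm : HasMFDerivAt 𝓘(ℝ, ℂ) 𝓘(ℝ, ℂ) γ.1 x
      (ContinuousLinearMap.restrictScalars ℝ (m • ContinuousLinearMap.id ℂ ℂ) : ℂ →L[ℝ] ℂ))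
    (v : ℂ) :
    diff (fun y => (ψ y : ℂ)) (γ.1 x) (m * v : ℂ) =
      (autFactor (ρ γ) (ψ x) ^ 2)⁻¹ * diff (fun y => (ψ y : ℂ)) x v := by
  obtain ⟨F, hF, hF'⟩ := exists_hasFDerivAt_moebius (ρ γ) (ψ x)
  have h1 := HasMFDerivAt.comp x (hharm.hasMFDerivAt (γ.1 x)) hm
  have h2 := HasMFDerivAt.comp x (HasFDerivAt.hasMFDerivAt hF') (hharm.hasMFDerivAt x)
  -- By equivariance the two composites are one function, so their chain-rule derivatives agree.
  have h3 : (fun y => (ψ y : ℂ)) ∘ γ.1 = F ∘ fun y => (ψ y : ℂ) :=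
    funext fun y => (congrArg _ (hequiv γ y)).trans (hF (ψ y))
  rw [h3] at h1
  exact DFunLike.congr_fun (hasMFDerivAt_unique h1 h2) v

/-- Precomposition with multiplication by `m` scales the linear part by `m` and the antilinear part
by `m̄`. The values of `diff_deck` at `1` and `i` separate the two parts. -/
theorem linearPart_deck {p : X → S} {ρ : deckGroup p →* SL(2, ℝ)} {ψ : X → ℍ}
    (hequiv : IsEquivariant p ρ ψ) (hharm : IsHarmonicMap ψ) (γ : deckGroup p) (x : X) {m : ℂ}
    (hm : HasMFDerivAt 𝓘(ℝ, ℂ) 𝓘(ℝ, ℂ) γ.1 x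
      (ContinuousLinearMap.restrictScalars ℝ (m • ContinuousLinearMap.id ℂ ℂ) : ℂ →L[ℝ] ℂ)) :
    linearPart ψ x = linearPart ψ (γ.1 x) * m * autFactor (ρ γ) (ψ x) ^ 2 ∧
    antilinearPart ψ x = antilinearPart ψ (γ.1 x) * conj m * autFactor (ρ γ) (ψ x) ^ 2 := by
  have hj := autFactor_ne_zero (ρ γ) (ψ x)
  have h1 := diff_deck hequiv hharm γ x hm 1
  have h2 := diff_deck hequiv hharm γ x hm Complex.I
  rw [diff_eq_linearPart_add, diff_eq_linearPart_add] at h1 h2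
  simp at h1 h2
  rw [eq_inv_mul_iff_mul_eq₀ (pow_ne_zero 2 hj)] at h1 h2
  constructor
  · linear_combination (-1 / 2) * h1 + (1 / 2) * Complex.I * h2 + (-1 / 2) * Complex.I_sq *
      (linearPart ψ (γ.1 x) * m * autFactor (ρ γ) (ψ x) ^ 2 -
        antilinearPart ψ (γ.1 x) * conj m * autFactor (ρ γ) (ψ x) ^ 2 -
        linearPart ψ x + antilinearPart ψ x)
  · linear_combination (-1 / 2) * h1 - (1 / 2) * Complex.I * h2 + (1 / 2) * Complex.I_sq *
      (linearPart ψ (γ.1 x) * m * autFactor (ρ γ) (ψ x) ^ 2 -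
        antilinearPart ψ (γ.1 x) * conj m * autFactor (ρ γ) (ψ x) ^ 2 -
        linearPart ψ x + antilinearPart ψ x)

theorem hyperbolicMetric_apply (τ : ℍ) (v w : ℂ) :
    hyperbolicMetric τ v w = (v * conj w).re / τ.im ^ 2 := by
  simp [hyperbolicMetric]

theorem hyperbolicArea_apply (τ : ℍ) (v w : ℂ) :
    hyperbolicArea τ v w = (conj v * w).im / τ.im ^ 2 := by
  simp [hyperbolicArea]
  ring

/-- Möbius maps are isometries: the derivative `j⁻²` scales the form by `|j|⁻⁴`, and `(Im τ)²`
scales by the same factor. -/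
theorem hyperbolicMetric_smul (g : SL(2, ℝ)) (τ : ℍ) (v w : ℂ) :
    hyperbolicMetric (g • τ) ((autFactor g τ ^ 2)⁻¹ * v) ((autFactor g τ ^ 2)⁻¹ * w) =
      hyperbolicMetric τ v w := by
  have hj : Complex.normSq (autFactor g τ) ≠ 0 :=
    (Complex.normSq_pos.2 (autFactor_ne_zero g τ)).ne'
  have h : (autFactor g τ ^ 2)⁻¹ * v * conj ((autFactor g τ ^ 2)⁻¹ * w) =
      ((Complex.normSq (autFactor g τ) ^ 2)⁻¹ : ℝ) * (v * conj w) := by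
    push_cast
    rw [← Complex.mul_conj]
    simp
    ring
  rw [hyperbolicMetric_apply, hyperbolicMetric_apply, h, Complex.re_ofReal_mul,
    im_smul_eq_div_normSq_autFactor]
  have := τ.im_ne_zero
  field_simp

theorem hyperbolicArea_smul (g : SL(2, ℝ)) (τ : ℍ) (v w : ℂ) :
    hyperbolicArea (g • τ) ((autFactor g τ ^ 2)⁻¹ * v) ((autFactor g τ ^ 2)⁻¹ * w) =
      hyperbolicArea τ v w := by
  have hj : Complex.normSq (autFactor g τ) ≠ 0 :=
    (Complex.normSq_pos.2 (autFactor_ne_zero g τ)).ne'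
  have h : conj ((autFactor g τ ^ 2)⁻¹ * v) * ((autFactor g τ ^ 2)⁻¹ * w) =
      ((Complex.normSq (autFactor g τ) ^ 2)⁻¹ : ℝ) * (conj v * w) := by
    push_cast
    rw [← Complex.mul_conj]
    simp
    ring
  rw [hyperbolicArea_apply, hyperbolicArea_apply, h, Complex.im_ofReal_mul,
    im_smul_eq_div_normSq_autFactor]
  have := τ.im_ne_zero
  field_simp

theorem pullbackMetric_deck {p : X → S} {ρ : deckGroup p →* SL(2, ℝ)} {ψ : X → ℍ}
    (hequiv : IsEquivariant p ρ ψ) (hharm : IsHarmonicMap ψ) (γ : deckGroup p) (x : X) (m : ℂ)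
    (hm : HasMFDerivAt 𝓘(ℝ, ℂ) 𝓘(ℝ, ℂ) γ.1 x
      (ContinuousLinearMap.restrictScalars ℝ (m • ContinuousLinearMap.id ℂ ℂ) : ℂ →L[ℝ] ℂ))
    (v w : ℂ) :
    pullbackMetric ψ (γ.1 x) (m * v : ℂ) (m * w : ℂ) = pullbackMetric ψ x v w := by
  refine Eq.trans ?_ (hyperbolicMetric_smul (ρ γ) (ψ x) _ _)
  rw [← hequiv γ x, ← diff_deck hequiv hharm γ x hm, ← diff_deck hequiv hharm γ x hm]
  rfl

theorem pullbackArea_deck {p : X → S} {ρ : deckGroup p →* SL(2, ℝ)} {ψ : X → ℍ}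
    (hequiv : IsEquivariant p ρ ψ) (hharm : IsHarmonicMap ψ) (γ : deckGroup p) (x : X) (m : ℂ)
    (hm : HasMFDerivAt 𝓘(ℝ, ℂ) 𝓘(ℝ, ℂ) γ.1 x
      (ContinuousLinearMap.restrictScalars ℝ (m • ContinuousLinearMap.id ℂ ℂ) : ℂ →L[ℝ] ℂ))
    (v w : ℂ) :
    pullbackArea ψ (γ.1 x) (m * v : ℂ) (m * w : ℂ) = pullbackArea ψ x v w := by
  refine Eq.trans ?_ (hyperbolicArea_smul (ρ γ) (ψ x) _ _)
  rw [← hequiv γ x, ← diff_deck hequiv hharm γ x hm, ← diff_deck hequiv hharm γ x hm]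
  rfl

end Equivariance

/-! ### Descent of invariant tensors along the covering. -/

section Descent

variable {X S : Type*} [TopologicalSpace X] [ChartedSpace ℂ X]
  [TopologicalSpace S] [ChartedSpace ℂ S]

/-- The differential of `p` at `x` in the preferred charts, as a complex number. -/
noncomputable def coverDeriv (p : X → S) (x : X) : ℂ := diffMap p x (1 : ℂ)

theorem IsUniversalCovering.hasMFDerivAt {p : X → S} (hp : IsUniversalCovering p) (x : X) :
    HasMFDerivAt 𝓘(ℝ, ℂ) 𝓘(ℝ, ℂ) p x
      (ContinuousLinearMap.restrictScalars ℝ (coverDeriv p x • ContinuousLinearMap.id ℂ ℂ) :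
        ℂ →L[ℝ] ℂ) := by
  obtain ⟨c, -, hc⟩ := hp.exists_hasMFDerivAt_mul x
  have h : coverDeriv p x = c := (diffMap_eq_of_hasMFDerivAt hc 1).trans (mul_one c)
  rwa [h]

theorem IsUniversalCovering.diffMap_eq {p : X → S} (hp : IsUniversalCovering p) (x : X) (v : ℂ) :
    (diffMap p x v : ℂ) = coverDeriv p x * v :=
  diffMap_eq_of_hasMFDerivAt (hp.hasMFDerivAt x) v

theorem IsUniversalCovering.coverDeriv_ne_zero {p : X → S} (hp : IsUniversalCovering p) (x : X) :
    coverDeriv p x ≠ 0 := by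
  obtain ⟨c, h0, hc⟩ := hp.exists_hasMFDerivAt_mul x
  have h : coverDeriv p x = c := (diffMap_eq_of_hasMFDerivAt hc 1).trans (mul_one c)
  rwa [h]

theorem IsUniversalCovering.coverDeriv_deck {p : X → S} (hp : IsUniversalCovering p)
    (γ : deckGroup p) (x : X) {m : ℂ} (hm : HasMFDerivAt 𝓘(ℝ, ℂ) 𝓘(ℝ, ℂ) γ.1 x
      (ContinuousLinearMap.restrictScalars ℝ (m • ContinuousLinearMap.id ℂ ℂ) : ℂ →L[ℝ] ℂ)) :
    coverDeriv p (γ.1 x) * m = coverDeriv p x := by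
  have h1 := HasMFDerivAt.comp x (hp.hasMFDerivAt (γ.1 x)) hm
  have h2 : p ∘ γ.1 = p := funext γ.2
  rw [h2] at h1
  have h3 : coverDeriv p (γ.1 x) * (m * 1) = coverDeriv p x * 1 :=
    DFunLike.congr_fun (hasMFDerivAt_unique h1 (hp.hasMFDerivAt x)) (1 : ℂ)
  simpa using h3

/-- Restates descent in preferred charts, where tangent vectors are complex numbers and the
differential of `p` is a multiplication. -/
theorem IsUniversalCovering.descends_iff {p : X → S} (hp : IsUniversalCovering p)
    {T : TwoTensor X} {g : TwoTensor S} : Descends p T g ↔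
      ∀ (x : X) (v w : ℂ), g (p x) (coverDeriv p x * v : ℂ) (coverDeriv p x * w : ℂ) = T x v w := by
  have key : ∀ (x : X) (v w : ℂ), g (p x) (coverDeriv p x * v : ℂ) (coverDeriv p x * w : ℂ) =
      (g (p x)).comp (diffMap p x) (diffMap p x) v w := fun x v w =>
    congrArg₂ (fun a b : ℂ => g (p x) a b) (hp.diffMap_eq x v).symm (hp.diffMap_eq x w).symm
  constructor
  · intro h x v w
    rw [key, h x]
  · intro h x
    refine LinearMap.ext₂ fun v w => ?_
    exact (key x v w).symm.trans (h x v w)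

/-- A tensor on a universal cover which is invariant under deck transformations descends to a
unique tensor on the base. -/
theorem IsUniversalCovering.exists_descends {p : X → S} (hp : IsUniversalCovering p)
    (T : TwoTensor X)
    (hT : ∀ (γ : deckGroup p) (x : X) (m : ℂ), HasMFDerivAt 𝓘(ℝ, ℂ) 𝓘(ℝ, ℂ) γ.1 x
      (ContinuousLinearMap.restrictScalars ℝ (m • ContinuousLinearMap.id ℂ ℂ) : ℂ →L[ℝ] ℂ) →
      ∀ v w : ℂ, T (γ.1 x) (m * v : ℂ) (m * w : ℂ) = T x v w) :
    ∃ g : TwoTensor S, ∀ g', Descends p T g' ↔ g' = g := by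
  have hB : ∀ s : S, ∃ B : LinearMap.BilinForm ℝ (TangentSpace 𝓘(ℝ, ℂ) s), ∀ x, p x = s →
      ∀ v w : ℂ, B (coverDeriv p x * v : ℂ) (coverDeriv p x * w : ℂ) = T x v w := by
    intro s
    obtain ⟨x₀, rfl⟩ := hp.surjective s
    -- The form at `s` is `T x₀` transported by the inverse of the differential of `p` at a chosen
    -- `x₀`. Any other point of the fiber is `γ x₀`, and the invariance of `T` gives the same form
    -- there.
    let A : ℂ →ₗ[ℝ] ℂ := LinearMap.mulLeft ℝ (coverDeriv p x₀)⁻¹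
    let B : LinearMap.BilinForm ℝ ℂ := LinearMap.BilinForm.comp (T x₀) A A
    refine ⟨B, fun x hx v w => ?_⟩
    obtain ⟨γ, rfl⟩ := hp.exists_deckGroup_apply_eq hx.symm
    obtain ⟨m, hm⟩ := hp.exists_hasMFDerivAt_deck γ x₀
    have hc := hp.coverDeriv_deck γ x₀ hm
    have h0 := hp.coverDeriv_ne_zero x₀
    have hm0 : m ≠ 0 := by
      rintro rfl
      exact h0 (by rw [← hc, mul_zero])
    have h1 := hT γ x₀ m hm (m⁻¹ * v) (m⁻¹ * w)
    rw [mul_inv_cancel_left₀ hm0, mul_inv_cancel_left₀ hm0] at h1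
    have h2 : ∀ u : ℂ, (coverDeriv p x₀)⁻¹ * (coverDeriv p (γ.1 x₀) * u) = m⁻¹ * u := fun u => by
      rw [← hc] at h0 ⊢
      have := left_ne_zero_of_mul h0
      field_simp
    exact (congrArg₂ (fun a b : ℂ => T x₀ a b) (h2 v) (h2 w)).trans h1.symm
  choose g hg using hB
  refine ⟨g, fun g' => ?_⟩
  rw [hp.descends_iff]
  constructor
  · intro h
    funext s
    obtain ⟨x, rfl⟩ := hp.surjective s
    -- Uniqueness: the differential of `p` is onto, so every pair of tangent vectors of `S` comes
    -- from `X`.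
    have h0 := hp.coverDeriv_ne_zero x
    refine LinearMap.ext₂ fun (v w : ℂ) => ?_
    have h1 := (h x ((coverDeriv p x)⁻¹ * v) ((coverDeriv p x)⁻¹ * w)).trans
      (hg (p x) x rfl _ _).symm
    rwa [mul_inv_cancel_left₀ h0, mul_inv_cancel_left₀ h0] at h1
  · rintro rfl x v w
    exact hg (p x) x rfl v w

end Descent

/-! ### Adapted frames: their transformation under deck maps and the weight `k`. -/

section Frames

variable {X S : Type*} [TopologicalSpace X] {p : X → S} {ρ : deckGroup p →* SL(2, ℝ)} {ψ : X → ℍ}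
  {U : Set S} {e e' : X → Fin 2 → ℂ}

/-- The squared norm of the section `e'` of `L⁻¹`, at a point of the universal cover. -/
noncomputable def metricWeight (ψ : X → ℍ) (e' : X → Fin 2 → ℂ) (x : X) : ℝ :=
  ‖e' x 1‖ ^ 2 * (2 * (ψ x).im)

/-- A real matrix `g` sends `(τ̄, 1)` to `j̄` times the vector `(conj (gτ), 1)`, so only the second
coordinate has to be followed. -/
theorem IsAdaptedFrame.e_deck (hf : IsAdaptedFrame p ρ ψ U e e') (γ : deckGroup p) {x : X}
    (hx : p x ∈ U) : e (γ.1 x) 1 = e x 1 * conj (autFactor (ρ γ) (ψ x)) := by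
  rw [hf.section_e γ x hx, eq_smul_of_mem_lineL (hf.mem_L x hx)]
  simp [Matrix.mulVec, dotProduct, Fin.sum_univ_two, autFactor]
  ring

theorem IsAdaptedFrame.e'_deck (hf : IsAdaptedFrame p ρ ψ U e e') (γ : deckGroup p) {x : X}
    (hx : p x ∈ U) : e' (γ.1 x) 1 = e' x 1 * autFactor (ρ γ) (ψ x) := by
  rw [hf.section_e' γ x hx, eq_smul_of_mem_lineLinv (hf.mem_Linv x hx)]
  simp [Matrix.mulVec, dotProduct, Fin.sum_univ_two, autFactor]
  ring

theorem IsAdaptedFrame.mul_eq_one (hf : IsAdaptedFrame p ρ ψ U e e') {x : X}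
    (hx : p x ∈ U) : 2 * (ψ x).im * (e x 1 * e' x 1) = 1 := by
  rw [← bilinMetric_smul_smul, ← eq_smul_of_mem_lineL (hf.mem_L x hx),
    ← eq_smul_of_mem_lineLinv (hf.mem_Linv x hx), hf.dual x hx]

/-- The product of the squared norms of `e` and `e'` is the square of `|2t e₁ e'₁|`, which duality
makes `1`. -/
theorem IsAdaptedFrame.inv_metricWeight (hf : IsAdaptedFrame p ρ ψ U e e') {x : X}
    (hx : p x ∈ U) : (metricWeight ψ e' x)⁻¹ = ‖e x 1‖ ^ 2 * (2 * (ψ x).im) := by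
  have h := congrArg norm (hf.mul_eq_one hx)
  have ht := (ψ x).im_pos
  simp only [norm_mul, Complex.norm_real, Complex.norm_ofNat, norm_one, Real.norm_eq_abs,
    abs_of_pos ht] at h
  apply inv_eq_of_mul_eq_one_left
  unfold metricWeight
  linear_combination (2 * (ψ x).im * (‖e x 1‖ * ‖e' x 1‖) + 1) * h

/-- The square of `|e'₁|` gains `|j|²`, while `Im ψ` loses it. -/
theorem metricWeight_deck (hequiv : IsEquivariant p ρ ψ) (hf : IsAdaptedFrame p ρ ψ U e e')
    (γ : deckGroup p) (x : X) (hx : p x ∈ U) :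
    metricWeight ψ e' (γ.1 x) = metricWeight ψ e' x := by
  have hj := (Complex.normSq_pos.2 (autFactor_ne_zero (ρ γ) (ψ x))).ne'
  unfold metricWeight
  rw [hf.e'_deck γ hx, hequiv γ x, im_smul_eq_div_normSq_autFactor, norm_mul, mul_pow,
    ← Complex.normSq_eq_norm_sq (autFactor _ _)]
  field_simp

end Frames

/-! ### The functions `α`, `β`, `k` on `S` and the local formulas. -/

section LocalExpression

variable {X S : Type*} [TopologicalSpace X] [ChartedSpace ℂ X]
  [TopologicalSpace S] [ChartedSpace ℂ S]

/-- The differential of the coordinate `z` at `s` in the preferred chart, as a complex number. -/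
noncomputable def chartDeriv (z : S → ℂ) (s : S) : ℂ := diff z s (1 : ℂ)

/-- The coefficient `α` of the Higgs field, computed at a point of the universal cover. -/
noncomputable def higgsAlpha (p : X → S) (ψ : X → ℍ) (z : S → ℂ) (e' : X → Fin 2 → ℂ) (x : X) : ℂ :=
  Complex.I * e' x 1 ^ 2 * linearPart ψ x / (chartDeriv z (p x) * coverDeriv p x)

/-- The coefficient `β` of the Higgs field, computed at a point of the universal cover. -/
noncomputable def higgsBeta (p : X → S) (ψ : X → ℍ) (z : S → ℂ) (e : X → Fin 2 → ℂ) (x : X) : ℂ :=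
  -Complex.I * e x 1 ^ 2 * conj (antilinearPart ψ x) / (chartDeriv z (p x) * coverDeriv p x)

/-- No regularity is required of `F`, so it may be read off at one chosen point of each fiber; its
values outside `U` do not matter. -/
theorem exists_comp_eq_of_deck_invariant {p : X → S} (hp : IsUniversalCovering p) {U : Set S}
    {Y : Type*} (f : X → Y)
    (hf : ∀ (γ : deckGroup p) (x : X), p x ∈ U → f (γ.1 x) = f x) :
    ∃ F : S → Y, ∀ x, p x ∈ U → F (p x) = f x := by
  refine ⟨fun s => f (Function.surjInv hp.surjective s), fun x hx => ?_⟩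
  obtain ⟨γ, hγ⟩ := hp.exists_deckGroup_apply_eq (Function.surjInv_eq hp.surjective (p x)).symm
  simp only
  rw [← hγ, hf γ x hx]

section

variable {p : X → S} {ρ : deckGroup p →* SL(2, ℝ)} {ψ : X → ℍ} {U : Set S} {e e' : X → Fin 2 → ℂ}

/-- Under `γ`, `e'₁²` gains `j²`, the linear part is divided by `m j²`, and the derivative of `p` is
divided by `m`. -/
theorem higgsAlpha_deck (hp : IsUniversalCovering p) (hequiv : IsEquivariant p ρ ψ)
    (hharm : IsHarmonicMap ψ) (hf : IsAdaptedFrame p ρ ψ U e e') (z : S → ℂ)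
    (γ : deckGroup p) (x : X) (hx : p x ∈ U) :
    higgsAlpha p ψ z e' (γ.1 x) = higgsAlpha p ψ z e' x := by
  obtain ⟨m, hm⟩ := hp.exists_hasMFDerivAt_deck γ x
  have hc := hp.coverDeriv_deck γ x hm
  have h0 := hp.coverDeriv_ne_zero x
  rw [← hc] at h0
  have hm0 := right_ne_zero_of_mul h0
  have hpx : p (γ.1 x) = p x := γ.2 x
  unfold higgsAlpha
  rw [hf.e'_deck γ hx, (linearPart_deck hequiv hharm γ x hm).1, ← hc, hpx,
    ← mul_assoc (chartDeriv z (p x)), ← mul_div_mul_right _ (_ * coverDeriv p (γ.1 x)) hm0]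
  congr 1
  ring

/-- As for `α`, with `j` replaced by `j̄`; conjugating the antilinear part turns its factor `m̄`
into `m`, which the derivative of `p` absorbs. -/
theorem higgsBeta_deck (hp : IsUniversalCovering p) (hequiv : IsEquivariant p ρ ψ)
    (hharm : IsHarmonicMap ψ) (hf : IsAdaptedFrame p ρ ψ U e e') (z : S → ℂ)
    (γ : deckGroup p) (x : X) (hx : p x ∈ U) :
    higgsBeta p ψ z e (γ.1 x) = higgsBeta p ψ z e x := by
  obtain ⟨m, hm⟩ := hp.exists_hasMFDerivAt_deck γ x
  have hc := hp.coverDeriv_deck γ x hm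
  have h0 := hp.coverDeriv_ne_zero x
  rw [← hc] at h0
  have hm0 := right_ne_zero_of_mul h0
  have hpx : p (γ.1 x) = p x := γ.2 x
  unfold higgsBeta
  rw [hf.e_deck γ hx, (linearPart_deck hequiv hharm γ x hm).2, ← hc, hpx,
    ← mul_assoc (chartDeriv z (p x)), ← mul_div_mul_right _ (_ * coverDeriv p (γ.1 x)) hm0]
  congr 1
  simp
  ring

end

theorem chartDeriv_ne_zero [IsManifold 𝓘(ℂ) ω S] {z : OpenPartialHomeomorph S ℂ}
    (hz : z ∈ IsManifold.maximalAtlas 𝓘(ℂ) ω S) {s : S} (hs : s ∈ z.source) :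
    chartDeriv z s ≠ 0 := by
  obtain ⟨c, h0, hc⟩ := exists_diff_chart_eq_mul hz hs
  have h : chartDeriv z s = c := (hc 1).trans (mul_one c)
  rwa [h]

theorem diff_chart_eq [IsManifold 𝓘(ℂ) ω S] {z : OpenPartialHomeomorph S ℂ}
    (hz : z ∈ IsManifold.maximalAtlas 𝓘(ℂ) ω S) {s : S} (hs : s ∈ z.source) (v : ℂ) :
    diff z s v = chartDeriv z s * v := by
  obtain ⟨c, h0, hc⟩ := exists_diff_chart_eq_mul hz hs
  have h : chartDeriv z s = c := (hc 1).trans (mul_one c)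
  rw [h, hc]

theorem isLocalExpression_of_comp_eq [IsManifold 𝓘(ℂ) ω S] {p : X → S}
    (hp : IsUniversalCovering p)
    {ρ : deckGroup p →* SL(2, ℝ)} {ψ : X → ℍ} (hharm : IsHarmonicMap ψ)
    {z : OpenPartialHomeomorph S ℂ} (hz : z ∈ IsManifold.maximalAtlas 𝓘(ℂ) ω S)
    {e e' : X → Fin 2 → ℂ} (hf : IsAdaptedFrame p ρ ψ z.source e e') {α β : S → ℂ} {k : S → ℝ}
    (hα : ∀ x, p x ∈ z.source → α (p x) = higgsAlpha p ψ z e' x)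
    (hβ : ∀ x, p x ∈ z.source → β (p x) = higgsBeta p ψ z e x)
    (hk : ∀ x, p x ∈ z.source → k (p x) = metricWeight ψ e' x) :
    IsLocalExpression p ψ z e e' α β k where
  pos s hs := by
    obtain ⟨x, rfl⟩ := hp.surjective s
    have h : e' x 1 ≠ 0 := fun h => by simpa [h] using hf.mul_eq_one hs
    have := (ψ x).im_pos
    rw [hk x hs, metricWeight]
    positivity
  metric_e x hx := by
    rw [hk x hx, hf.inv_metricWeight hx, eq_smul_of_mem_lineL (hf.mem_L x hx),
      hermMetric_conj_conj]
    simp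
  metric_e' x hx := by
    rw [hk x hx, metricWeight, eq_smul_of_mem_lineLinv (hf.mem_Linv x hx), hermMetric_coe_coe]
    simp
  orthogonal x hx := by
    rw [eq_smul_of_mem_lineL (hf.mem_L x hx), eq_smul_of_mem_lineLinv (hf.mem_Linv x hx),
      hermMetric_conj_coe]
  higgs_e x hx v := by
    change ℂ at v
    have hq : diff z (p x) (diffMap p x v) = chartDeriv z (p x) * (coverDeriv p x * v) :=
      (congrArg (fun u : ℂ => diff z (p x) u) (hp.diffMap_eq x v)).trans (diff_chart_eq hz hx _)
    have hc := hp.coverDeriv_ne_zero x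
    have hζ := chartDeriv_ne_zero hz hx
    have ht : ((ψ x).im : ℂ) ≠ 0 := by exact_mod_cast (ψ x).im_ne_zero
    have h1 := hf.mul_eq_one hx
    rw [hq, hβ x hx, higgsBeta, eq_smul_of_mem_lineLinv (hf.mem_Linv x hx), smul_smul]
    conv_lhs => rw [eq_smul_of_mem_lineL (hf.mem_L x hx)]
    rw [Matrix.mulVec_smul, higgsField_mulVec_conj hharm, smul_smul]
    congr 1
    simp
    field_simp
    -- The two sides differ only by the duality factor `2t e₁ e'₁ = 1`.
    linear_combination (e x 1 * conj (antilinearPart ψ x) * v) * h1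
  higgs_e' x hx v := by
    change ℂ at v
    have hq : diff z (p x) (diffMap p x v) = chartDeriv z (p x) * (coverDeriv p x * v) :=
      (congrArg (fun u : ℂ => diff z (p x) u) (hp.diffMap_eq x v)).trans (diff_chart_eq hz hx _)
    have hc := hp.coverDeriv_ne_zero x
    have hζ := chartDeriv_ne_zero hz hx
    have ht : ((ψ x).im : ℂ) ≠ 0 := by exact_mod_cast (ψ x).im_ne_zero
    have h1 := hf.mul_eq_one hx
    rw [hq, hα x hx, higgsAlpha, eq_smul_of_mem_lineL (hf.mem_L x hx), smul_smul]
    conv_lhs => rw [eq_smul_of_mem_lineLinv (hf.mem_Linv x hx)]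
    rw [Matrix.mulVec_smul, higgsField_mulVec_coe hharm, smul_smul]
    congr 1
    field_simp
    linear_combination (-(e' x 1) * linearPart ψ x * v) * h1

section

variable {p : X → S} {ρ : deckGroup p →* SL(2, ℝ)} {ψ : X → ℍ} {U : Set S} {e e' : X → Fin 2 → ℂ}

/-- The frame enters only through `e₁ e'₁ = 1 / 2t`, so it disappears from the product. -/
theorem higgsAlpha_mul_higgsBeta (hf : IsAdaptedFrame p ρ ψ U e e') (z : S → ℂ) {x : X}
    (hx : p x ∈ U) :
    4 * higgsAlpha p ψ z e' x * higgsBeta p ψ z e x =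
      linearPart ψ x * conj (antilinearPart ψ x) /
        ((ψ x).im ^ 2 * (chartDeriv z (p x) * coverDeriv p x) ^ 2) := by
  have ht : ((ψ x).im : ℂ) ≠ 0 := by exact_mod_cast (ψ x).im_ne_zero
  have h := hf.mul_eq_one hx
  have h2 : e x 1 * e' x 1 = 1 / (2 * (ψ x).im) := by
    rw [eq_div_iff (by simpa using ht)]
    linear_combination h
  have h3 : 4 * higgsAlpha p ψ z e' x * higgsBeta p ψ z e x =
      -(4 * Complex.I ^ 2 * (e x 1 * e' x 1) ^ 2 *
        (linearPart ψ x * conj (antilinearPart ψ x))) /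
        (chartDeriv z (p x) * coverDeriv p x) ^ 2 := by
    unfold higgsAlpha higgsBeta
    ring
  rw [h3, h2, Complex.I_sq]
  field_simp
  norm_num

/-- Since `|e'₁|² = k / 2t`, the factor `k⁻²` cancels the frame in `|α|²`. For `β`, the roles of `k`
and `k⁻¹` are exchanged. -/
theorem norm_higgsAlpha (hf : IsAdaptedFrame p ρ ψ U e e') (z : S → ℂ) {x : X} (hx : p x ∈ U) :
    4 * ((metricWeight ψ e' x)⁻¹ ^ 2 * ‖higgsAlpha p ψ z e' x‖ ^ 2) =
      ‖linearPart ψ x‖ ^ 2 / ((ψ x).im ^ 2 * ‖chartDeriv z (p x) * coverDeriv p x‖ ^ 2) := by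
  have ht := (ψ x).im_ne_zero
  have h : metricWeight ψ e' x ≠ 0 := fun h => by
    have h1 := hf.mul_eq_one hx
    have h2 : e' x 1 ≠ 0 := fun h => by simp [h] at h1
    simp [metricWeight, ht, h2] at h
  have h2 : ‖e' x 1‖ ^ 2 = metricWeight ψ e' x / (2 * (ψ x).im) := by
    rw [metricWeight]
    field_simp
  rw [higgsAlpha, norm_div, norm_mul, norm_mul, norm_pow, h2, Complex.norm_I]
  field_simp
  norm_num

theorem norm_higgsBeta (hf : IsAdaptedFrame p ρ ψ U e e') (z : S → ℂ) {x : X} (hx : p x ∈ U) :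
    4 * (metricWeight ψ e' x ^ 2 * ‖higgsBeta p ψ z e x‖ ^ 2) =
      ‖antilinearPart ψ x‖ ^ 2 / ((ψ x).im ^ 2 * ‖chartDeriv z (p x) * coverDeriv p x‖ ^ 2) := by
  have ht := (ψ x).im_ne_zero
  have h : metricWeight ψ e' x ≠ 0 := fun h => by
    have h1 := hf.mul_eq_one hx
    have h2 : e' x 1 ≠ 0 := fun h => by simp [h] at h1
    simp [metricWeight, ht, h2] at h
  have h2 : ‖e x 1‖ ^ 2 = (metricWeight ψ e' x)⁻¹ / (2 * (ψ x).im) := by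
    rw [hf.inv_metricWeight hx]
    field_simp
  rw [higgsBeta, norm_div, norm_mul, norm_mul, norm_pow, h2, norm_neg, Complex.norm_I,
    Complex.norm_conj]
  field_simp
  norm_num

end

theorem pullbackMetric_apply (ψ : X → ℍ) (x : X) (v w : ℂ) :
    ((pullbackMetric ψ x v w : ℝ) : ℂ) =
      (linearPart ψ x * conj (antilinearPart ψ x) * (v * w) +
        ((‖antilinearPart ψ x‖ ^ 2 + ‖linearPart ψ x‖ ^ 2 : ℝ) : ℂ) *
          ((1 / 2) * (v * conj w + conj v * w)) +
        conj (linearPart ψ x) * antilinearPart ψ x * (conj v * conj w)) / (ψ x).im ^ 2 := by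
  have h : pullbackMetric ψ x v w =
      ((linearPart ψ x * v + antilinearPart ψ x * conj v) *
        conj (linearPart ψ x * w + antilinearPart ψ x * conj w)).re / (ψ x).im ^ 2 := by
    rw [← diff_eq_linearPart_add, ← diff_eq_linearPart_add, ← hyperbolicMetric_apply]
    rfl
  rw [h, Complex.ofReal_div, Complex.re_eq_add_conj, Complex.ofReal_pow, Complex.ofReal_add,
    Complex.ofReal_pow, Complex.ofReal_pow, ← Complex.mul_conj', ← Complex.mul_conj']
  congr 1
  simp
  ring

/-- On expanding, the cross terms `A B̄ v w` and `Ā B v̄ w̄` are conjugate and have real sum. The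
other two carry `v̄ w` and its conjugate, whence the difference of squares. -/
theorem pullbackArea_apply (ψ : X → ℍ) (x : X) (v w : ℂ) :
    pullbackArea ψ x v w =
      (‖linearPart ψ x‖ ^ 2 - ‖antilinearPart ψ x‖ ^ 2) * (conj v * w).im / (ψ x).im ^ 2 := by
  have h : pullbackArea ψ x v w =
      (conj (linearPart ψ x * v + antilinearPart ψ x * conj v) *
        (linearPart ψ x * w + antilinearPart ψ x * conj w)).im / (ψ x).im ^ 2 := by
    rw [← diff_eq_linearPart_add, ← diff_eq_linearPart_add, ← hyperbolicArea_apply]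
    rfl
  rw [h, ← Complex.normSq_eq_norm_sq, ← Complex.normSq_eq_norm_sq, Complex.normSq_apply,
    Complex.normSq_apply]
  congr 1
  simp
  ring

/-- The local formulas for the descended metric and area form. -/
theorem exists_isLocalExpression [IsManifold 𝓘(ℂ) ω S] {p : X → S} (hp : IsUniversalCovering p)
    {ρ : deckGroup p →* SL(2, ℝ)} {ψ : X → ℍ} (hequiv : IsEquivariant p ρ ψ)
    (hharm : IsHarmonicMap ψ) {g vol : TwoTensor S} (hg : Descends p (pullbackMetric ψ) g)
    (hvol : Descends p (pullbackArea ψ) vol)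
    (z : OpenPartialHomeomorph S ℂ) (hz : z ∈ IsManifold.maximalAtlas 𝓘(ℂ) ω S)
    (e e' : X → Fin 2 → ℂ) (hf : IsAdaptedFrame p ρ ψ z.source e e') :
    ∃ (α β : S → ℂ) (k : S → ℝ),
      IsLocalExpression p ψ z e e' α β k ∧
      ∀ x ∈ z.source, ∀ v w : TangentSpace 𝓘(ℝ, ℂ) x,
        ((g x v w : ℝ) : ℂ) =
            4 * α x * β x * dzdz z x v w
          + 4 * (k x ^ 2 * ‖β x‖ ^ 2 + (k x)⁻¹ ^ 2 * ‖α x‖ ^ 2 : ℝ) * dzdzbar z x v w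
          + 4 * conj (α x) * conj (β x) * dzbardzbar z x v w ∧
        vol x v w =
          4 * ((k x)⁻¹ ^ 2 * ‖α x‖ ^ 2 - k x ^ 2 * ‖β x‖ ^ 2) * dxwedgedy z x v w := by
  obtain ⟨α, hα⟩ := exists_comp_eq_of_deck_invariant hp _ (higgsAlpha_deck hp hequiv hharm hf z)
  obtain ⟨β, hβ⟩ := exists_comp_eq_of_deck_invariant hp _ (higgsBeta_deck hp hequiv hharm hf z)
  obtain ⟨k, hk⟩ := exists_comp_eq_of_deck_invariant hp _ (metricWeight_deck hequiv hf)
  refine ⟨α, β, k, isLocalExpression_of_comp_eq hp hharm hz hf hα hβ hk, fun s hs => ?_⟩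
  obtain ⟨x, rfl⟩ := hp.surjective s
  have hc := hp.coverDeriv_ne_zero x
  have hζ := chartDeriv_ne_zero hz hs
  -- The differential of `p` is invertible, so it is enough to test on images of tangent vectors of
  -- `X`, where the descended tensors are the pull-backs by `ψ`.
  suffices h : ∀ v w : ℂ,
      ((g (p x) (coverDeriv p x * v : ℂ) (coverDeriv p x * w : ℂ) : ℝ) : ℂ) =
            4 * α (p x) * β (p x) * dzdz z (p x) (coverDeriv p x * v : ℂ) (coverDeriv p x * w : ℂ)
          + 4 * (k (p x) ^ 2 * ‖β (p x)‖ ^ 2 + (k (p x))⁻¹ ^ 2 * ‖α (p x)‖ ^ 2 : ℝ) *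
            dzdzbar z (p x) (coverDeriv p x * v : ℂ) (coverDeriv p x * w : ℂ)
          + 4 * conj (α (p x)) * conj (β (p x)) *
            dzbardzbar z (p x) (coverDeriv p x * v : ℂ) (coverDeriv p x * w : ℂ) ∧
        vol (p x) (coverDeriv p x * v : ℂ) (coverDeriv p x * w : ℂ) =
          4 * ((k (p x))⁻¹ ^ 2 * ‖α (p x)‖ ^ 2 - k (p x) ^ 2 * ‖β (p x)‖ ^ 2) *
            dxwedgedy z (p x) (coverDeriv p x * v : ℂ) (coverDeriv p x * w : ℂ) by
    intro (v : ℂ) (w : ℂ)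
    have h1 := h ((coverDeriv p x)⁻¹ * v) ((coverDeriv p x)⁻¹ * w)
    rwa [mul_inv_cancel_left₀ hc, mul_inv_cancel_left₀ hc] at h1
  intro v w
  rw [hp.descends_iff.1 hg, hp.descends_iff.1 hvol, hα x hs, hβ x hs, hk x hs,
    pullbackMetric_apply, pullbackArea_apply]
  have hd : ∀ u : ℂ, diff z (p x) (coverDeriv p x * u : ℂ) =
      chartDeriv z (p x) * coverDeriv p x * u := fun u => by
    rw [diff_chart_eq hz hs, mul_assoc]
  have hA := norm_higgsAlpha hf z hs
  have hB := norm_higgsBeta hf z hs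
  have hAB := higgsAlpha_mul_higgsBeta hf z hs
  have hAB' := congrArg conj hAB
  have hq : chartDeriv z (p x) * coverDeriv p x ≠ 0 := mul_ne_zero hζ hc
  have ht := (ψ x).im_ne_zero
  unfold dzdz dzdzbar dzbardzbar dxwedgedy
  rw [hd, hd]
  -- Only the derivative `q` of `z ∘ p` remains: `dz` contributes `q` and `α`, `β` contribute `q⁻¹`,
  -- so all powers of `q` and `q̄` cancel.
  generalize chartDeriv z (p x) * coverDeriv p x = q at *
  have hqn : ‖q‖ ≠ 0 := norm_ne_zero_iff.2 hq
  constructor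
  · have hS : (4 : ℂ) * ((metricWeight ψ e' x ^ 2 * ‖higgsBeta p ψ z e x‖ ^ 2 +
        (metricWeight ψ e' x)⁻¹ ^ 2 * ‖higgsAlpha p ψ z e' x‖ ^ 2 : ℝ) : ℂ) =
        ((‖antilinearPart ψ x‖ ^ 2 + ‖linearPart ψ x‖ ^ 2 : ℝ) : ℂ) /
          ((ψ x).im ^ 2 * (q * conj q)) := by
      rw [Complex.mul_conj']
      have h : 4 * (metricWeight ψ e' x ^ 2 * ‖higgsBeta p ψ z e x‖ ^ 2 +
          (metricWeight ψ e' x)⁻¹ ^ 2 * ‖higgsAlpha p ψ z e' x‖ ^ 2) =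
          (‖antilinearPart ψ x‖ ^ 2 + ‖linearPart ψ x‖ ^ 2) / ((ψ x).im ^ 2 * ‖q‖ ^ 2) := by
        rw [mul_add, hA, hB, ← add_div]
      exact_mod_cast h
    have hAB'' : 4 * conj (higgsAlpha p ψ z e' x) * conj (higgsBeta p ψ z e x) =
        conj (linearPart ψ x) * antilinearPart ψ x / ((ψ x).im ^ 2 * conj q ^ 2) := by
      simpa [Complex.conj_ofNat] using hAB'
    rw [hAB, hS, hAB'']
    have hq' : conj q ≠ 0 := by simpa using hq
    have ht' : ((ψ x).im : ℂ) ≠ 0 := by exact_mod_cast ht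
    simp only [map_mul]
    field_simp
  · have him : (q * v).re * (q * w).im - (q * v).im * (q * w).re =
        ‖q‖ ^ 2 * (conj v * w).im := by
      rw [← Complex.normSq_eq_norm_sq, Complex.normSq_apply]
      simp
      ring
    rw [him, mul_sub, hA, hB]
    field_simp

/-- The pull-backs of the hyperbolic metric and area form descend to unique tensors. -/
theorem exists_descended_tensors [IsManifold 𝓘(ℂ) ω S] {p : X → S} (hp : IsUniversalCovering p)
    {ρ : deckGroup p →* SL(2, ℝ)} {ψ : X → ℍ} (hequiv : IsEquivariant p ρ ψ)
    (hharm : IsHarmonicMap ψ) :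
    ∃ g vol : TwoTensor S,
      (∀ g', Descends p (pullbackMetric ψ) g' ↔ g' = g) ∧
      (∀ g', Descends p (pullbackArea ψ) g' ↔ g' = vol) := by
  obtain ⟨g, hg⟩ := hp.exists_descends _ (pullbackMetric_deck hequiv hharm)
  obtain ⟨vol, hvol⟩ := hp.exists_descends _ (pullbackArea_deck hequiv hharm)
  exact ⟨g, vol, hg, hvol⟩

end LocalExpression

end HiggsSL2

theorem mainTheorem8 {X S : Type*}
    [TopologicalSpace S] [T2Space S] [CompactSpace S] [ConnectedSpace S]
    [ChartedSpace ℂ S] [IsManifold 𝓘(ℂ) ω S]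
    [TopologicalSpace X] [ChartedSpace ℂ X] [IsManifold 𝓘(ℂ) ω X]
    (p : X → S) (hp : HiggsSL2.IsUniversalCovering p)
    (ρ₁ ρ₂ : HiggsSL2.deckGroup p →* SL(2, ℝ)) (ψ₁ ψ₂ : X → ℍ)
    (hequiv₁ : HiggsSL2.IsEquivariant p ρ₁ ψ₁) (hharm₁ : HiggsSL2.IsHarmonicMap ψ₁)
    (hequiv₂ : HiggsSL2.IsEquivariant p ρ₂ ψ₂) (hharm₂ : HiggsSL2.IsHarmonicMap ψ₂) :
    ∃ g₁ vol₁ g₂ vol₂ : HiggsSL2.TwoTensor S,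
      -- the pull-backs of the hyperbolic metric and area form descend to unique tensors on `S`
      (∀ g, HiggsSL2.Descends p (HiggsSL2.pullbackMetric ψ₁) g ↔ g = g₁) ∧
      (∀ g, HiggsSL2.Descends p (HiggsSL2.pullbackArea ψ₁) g ↔ g = vol₁) ∧
      (∀ g, HiggsSL2.Descends p (HiggsSL2.pullbackMetric ψ₂) g ↔ g = g₂) ∧
      (∀ g, HiggsSL2.Descends p (HiggsSL2.pullbackArea ψ₂) g ↔ g = vol₂) ∧
      (∀ z ∈ IsManifold.maximalAtlas 𝓘(ℂ) ω S, ∀ e e' : X → Fin 2 → ℂ,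
        HiggsSL2.IsAdaptedFrame p ρ₁ ψ₁ z.source e e' →
        ∃ (α β : S → ℂ) (k : S → ℝ),
          HiggsSL2.IsLocalExpression p ψ₁ z e e' α β k ∧
          ∀ x ∈ z.source, ∀ v w : TangentSpace 𝓘(ℝ, ℂ) x,
            ((g₁ x v w : ℝ) : ℂ) =
                4 * α x * β x * HiggsSL2.dzdz z x v w
              + 4 * (k x ^ 2 * ‖β x‖ ^ 2 + (k x)⁻¹ ^ 2 * ‖α x‖ ^ 2 : ℝ)
                  * HiggsSL2.dzdzbar z x v w
              + 4 * conj (α x) * conj (β x) * HiggsSL2.dzbardzbar z x v w ∧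
            vol₁ x v w =
              4 * ((k x)⁻¹ ^ 2 * ‖α x‖ ^ 2 - k x ^ 2 * ‖β x‖ ^ 2)
                * HiggsSL2.dxwedgedy z x v w) ∧
      (∀ z ∈ IsManifold.maximalAtlas 𝓘(ℂ) ω S, ∀ n n' : X → Fin 2 → ℂ,
        HiggsSL2.IsAdaptedFrame p ρ₂ ψ₂ z.source n n' →
        ∃ (γ δ : S → ℂ) (h : S → ℝ),
          HiggsSL2.IsLocalExpression p ψ₂ z n n' γ δ h ∧
          ∀ x ∈ z.source, ∀ v w : TangentSpace 𝓘(ℝ, ℂ) x,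
            ((g₂ x v w : ℝ) : ℂ) =
                4 * γ x * δ x * HiggsSL2.dzdz z x v w
              + 4 * (h x ^ 2 * ‖δ x‖ ^ 2 + (h x)⁻¹ ^ 2 * ‖γ x‖ ^ 2 : ℝ)
                  * HiggsSL2.dzdzbar z x v w
              + 4 * conj (γ x) * conj (δ x) * HiggsSL2.dzbardzbar z x v w ∧
            vol₂ x v w =
              4 * ((h x)⁻¹ ^ 2 * ‖γ x‖ ^ 2 - h x ^ 2 * ‖δ x‖ ^ 2)
                * HiggsSL2.dxwedgedy z x v w) := by
  obtain ⟨g₁, vol₁, hg₁, hvol₁⟩ := HiggsSL2.exists_descended_tensors hp hequiv₁ hharm₁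
  obtain ⟨g₂, vol₂, hg₂, hvol₂⟩ := HiggsSL2.exists_descended_tensors hp hequiv₂ hharm₂
  exact ⟨g₁, vol₁, g₂, vol₂, hg₁, hvol₁, hg₂, hvol₂,
    HiggsSL2.exists_isLocalExpression hp hequiv₁ hharm₁ ((hg₁ _).2 rfl) ((hvol₁ _).2 rfl),
    HiggsSL2.exists_isLocalExpression hp hequiv₂ hharm₂ ((hg₂ _).2 rfl) ((hvol₂ _).2 rfl)⟩
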